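/- For a prime $p$ and an integer $k\ge 1$, call a subset $A\subseteq\mathbb F_p$ \emph{$S_k$-type} if for every $a\in A$ there is $d\in\mathbb F_p\setminus\{0\}$ with $a+id\in A$ for all integers $-k\le i\le k$. Call $A$ \emph{$N_k$-type} if it is $S_k$-type and, in addition, for every $a\in\mathbb F_p\setminus A$ there is $d\in\mathbb F_p\setminus\{0\}$ with $a+id\in A$ for all $1\le i\le k$. Let $S_k(p)$ and $N_k(p)$ denote the smallest size of a nonempty $S_k$-type, respectively nonempty $N_k$-type, subset of $\mathbb F_p$. For $v\in\mathbb F_p^n$ let $g^v$ denote the corresponding basis element of the group ring $\mathbb F_p[\mathbb F_p^n]$ of the additive group $\mathbb F_p^n$ (so $g^vg^w=g^{v+w}$), and let $e_1,\dots,e_n$ be the standard basis vectors of $\mathbb F_p^n$. (i) Let $p$ be a prime and $k$ an integer with $p>k\ge 1$ and $N_k(p)\cdot S_k(p)<p-1$. Let $M$ be a nonsingular $n\times n$ matrix over $\mathbb F_p$ with rows $a_1,\dots,a_n$. Then $$\prod_{i=1}^n(1-g^{e_i})^k\cdot\prod_{i=1}^n(1-g^{a_i})^k\neq 0\quad\text{in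 } \mathbb F_p[\mathbb F_p^n].$$ (ii) Let $p$ be a prime with $61<p\neq 79$, let $M$ be a nonsingular $n\times n$ matrix over $\mathbb F_p$, and let $c_1,\dots,c_n,d_1,\dots,d_n\in\mathbb F_p$ be arbitrary. Then there is a vector $x\in\mathbb F_p^n$ such that $x_i\neq c_i$ and $(Mx)_i\neq d_i$ for all $1\le i\le n$. In particular (taking all $c_i=d_i=0$), the Alon–Jaeger–Tarsi conjecture holds over $\mathbb F_p$ for these primes: there is $x$ such that both $x$ and $Mx$ have only nonzero entries. (iii) There is a universal constant $K$ such that the following holds. Let $k\ge 2$ be an integer, $p$ a prime with $p>k^{Kk}$, and $M$ a nonsingular $n\times n$ matrix over $\mathbb F_p$. For each $1\le i\le n$ let $c_{i,1},\dots,c_{i,k}\in\mathbb F_p$ be $k$ different residues and let $d_{i,1},\dots,d_{i,k}\in\mathbb F_p$ be $k$ different residues. Then there is a vector $x\in\mathbb F_p^n$ such that $x_i\neq c_{i,\ell}$ and $(Mx)_i\neq d_{i,\ell}$ for all $1\le i\le n$ and $1\le\ell\le k$. -/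

import Mathlib

namespace AJT

/-- `A ⊆ 𝔽_p` is of `S_k`-type: every element of `A` is the middle term of a nonconstant
`(2k+1)`-term arithmetic progression contained in `A`. -/
def IsSType (k : ℕ) {p : ℕ} (A : Finset (ZMod p)) : Prop :=
  ∀ a ∈ A, ∃ d : ZMod p, d ≠ 0 ∧
    ∀ i : ℤ, -(k : ℤ) ≤ i → i ≤ (k : ℤ) → a + (i : ZMod p) * d ∈ A

/-- `A ⊆ 𝔽_p` is of `N_k`-type: it is of `S_k`-type, and for every `a ∉ A` there is a nonzero `d`
with `a + d, a + 2d, …, a + kd ∈ A`. -/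
def IsNType (k : ℕ) {p : ℕ} (A : Finset (ZMod p)) : Prop :=
  IsSType k A ∧
    ∀ a ∉ A, ∃ d : ZMod p, d ≠ 0 ∧
      ∀ i : ℤ, 1 ≤ i → i ≤ (k : ℤ) → a + (i : ZMod p) * d ∈ A

/-- `S_k(p)`: the least size of a nonempty `S_k`-type subset of `𝔽_p`
(for `p` prime, `𝔽_p` itself is such a subset). -/
noncomputable def S (k p : ℕ) : ℕ :=
  sInf {m : ℕ | ∃ A : Finset (ZMod p), A.Nonempty ∧ IsSType k A ∧ A.card = m}

/-- `N_k(p)`: the least size of a nonempty `N_k`-type subset of `𝔽_p`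
(for `p` prime, `𝔽_p` itself is such a subset). -/
noncomputable def N (k p : ℕ) : ℕ :=
  sInf {m : ℕ | ∃ A : Finset (ZMod p), A.Nonempty ∧ IsNType k A ∧ A.card = m}

/-- The group ring `𝔽_p[𝔽_p^n]` of the additive group `𝔽_p^n`. -/
abbrev GroupRing (p n : ℕ) : Type := AddMonoidAlgebra (ZMod p) (Fin n → ZMod p)

/-- The basis element `g^v` of the group ring, for `v ∈ 𝔽_p^n`. -/
noncomputable def g {p n : ℕ} (v : Fin n → ZMod p) : GroupRing p n :=
  AddMonoidAlgebra.single v 1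

end AJT

/-! Suppose the product over unit vectors and rows vanishes. The row factors alone have nonzero
product, by linear independence; keep them and delete unit-vector factors for as long as the product
stays zero, and let `J` be the set of coordinates still present. Consider the combinations `∑ z_i
v_i` of the remaining vectors, with `z_i` in `A` for unit vectors and in `B` for rows. Comparing
supports in the minimal vanishing product shows that they are closed under translation by every
multiple of a remaining unit vector (`exists_sum_smul_eq_add_smul`), so they form a union of cosets
of `𝔽_p^J`. Pigeonhole modulo `𝔽_p^J` finds a coset reached by at most `(|A| |B|)^(r|J|)` choices,
fewer than its `p^|J|` points (`prod_mul_prod_ne_zero`).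

Avoidance follows by contraposition: a covering by hyperplanes kills a twisted product over
`ℤ[ζ_p]`, and `ζ ↦ 1` turns it into the product above (`prod_one_sub_g_eq_zero_of_cover`).

It remains to find small sets. A nonempty `S_1` set is an `N_1` set, and repeated halving of `p`
gives one of logarithmic size. Part (ii) uses `r = 1`, with explicit sets for small primes; part
(iii) uses the same `S_1` sets, each factor being repeated `r` times for `r` forbidden values. -/

namespace AJT

/-! ### Supports and translation invariance in the group ring -/

section GroupRing

variable {p n : ℕ}

theorem g_zero : g (0 : Fin n → ZMod p) = 1 := rfl

theorem g_add (v w : Fin n → ZMod p) : g (v + w) = g v * g w := by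
  simp [g, AddMonoidAlgebra.single_mul_single]

theorem g_nsmul (m : ℕ) (v : Fin n → ZMod p) : g (m • v) = g v ^ m := by
  induction m with
  | zero => simp [g_zero]
  | succ m ih => rw [succ_nsmul, g_add, ih, pow_succ]

theorem one_sub_g_dvd_smul [NeZero p] (d : ZMod p) (v : Fin n → ZMod p) :
    1 - g v ∣ 1 - g (d • v) := by
  have h : d • v = d.val • v := by
    ext i
    simp
  rw [h, g_nsmul]
  exact one_sub_dvd_one_sub_pow _ _

/-- With the previous divisibility, this makes `1 - g v` and `1 - g (d • v)` associates, so step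
lengths may be changed without affecting whether a product vanishes. -/
theorem one_sub_g_smul_dvd [Fact p.Prime] {d : ZMod p} (hd : d ≠ 0) (v : Fin n → ZMod p) :
    1 - g (d • v) ∣ 1 - g v := by
  simpa [smul_smul, hd] using one_sub_g_dvd_smul d⁻¹ (d • v)

theorem coeff_g_mul (v w : Fin n → ZMod p) (F : GroupRing p n) :
    (g v * F).coeff w = F.coeff (w - v) := by
  have h := AddMonoidAlgebra.coeff_single_mul_add F (1 : ZMod p) v (w - v)
  simpa [g] using h

theorem coeff_one_sub_g_pow_mul (k : ℕ) (v w : Fin n → ZMod p) (F : GroupRing p n) :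
    ((1 - g v) ^ k * F).coeff w =
      ∑ i ∈ Finset.range (k + 1), (-1) ^ i * (k.choose i : ZMod p) * F.coeff (w - i • v) := by
  have h : (1 - g v : GroupRing p n) ^ k * F =
      ∑ i ∈ Finset.range (k + 1), ((-1) ^ i * (k.choose i : ZMod p)) • (g (i • v) * F) := by
    rw [sub_eq_neg_add, add_pow, Finset.sum_mul]
    refine Finset.sum_congr rfl fun i _ => ?_
    rw [g_nsmul, neg_pow, Algebra.smul_def, map_mul, map_pow, map_neg, map_one, map_natCast]
    ring
  rw [h, AddMonoidAlgebra.coeff_sum, Finsupp.finsetSum_apply]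
  refine Finset.sum_congr rfl fun i _ => ?_
  rw [AddMonoidAlgebra.coeff_smul_apply, coeff_g_mul, smul_eq_mul]

/-- The support of `∏ (1 - g^{w_i})^k` consists of sums `∑ s_i w_i` with `0 ≤ s_i ≤ k`. -/
theorem exists_eq_sum_of_coeff_prod_ne_zero {ι : Type*} [DecidableEq ι] (k : ℕ) (S : Finset ι)
    (w : ι → Fin n → ZMod p) (u : Fin n → ZMod p)
    (hu : (∏ i ∈ S, (1 - g (w i) : GroupRing p n) ^ k).coeff u ≠ 0) :
    ∃ s : ι → ℕ, (∀ i, s i ≤ k) ∧ u = ∑ i ∈ S, s i • w i := by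
  induction S using Finset.induction_on generalizing u with
  | empty =>
    refine ⟨fun _ => 0, by simp, ?_⟩
    by_contra h
    apply hu
    rw [Finset.prod_empty, AddMonoidAlgebra.one_def, AddMonoidAlgebra.coeff_single,
      Finsupp.single_apply, if_neg]
    simpa [eq_comm] using h
  | insert a S ha ih =>
    rw [Finset.prod_insert ha, coeff_one_sub_g_pow_mul] at hu
    obtain ⟨i, hi, hne⟩ := Finset.exists_ne_zero_of_sum_ne_zero hu
    obtain ⟨s, hs, hsum⟩ := ih _ (right_ne_zero_of_mul hne)
    refine ⟨Function.update s a i, fun j => ?_, ?_⟩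
    · by_cases hj : j = a
      · subst hj
        simpa [Nat.lt_succ_iff] using hi
      · simpa [hj] using hs j
    · rw [Finset.sum_insert ha, Function.update_self, sub_eq_iff_eq_add'.mp hsum]
      congr 1
      refine Finset.sum_congr rfl fun j hj => ?_
      rw [Function.update_of_ne (by rintro rfl; exact ha hj)]

/-- For linearly independent `w_i`, the constant coefficient of `∏ (1 - g^{w_i})^k` is `1`. -/
theorem prod_one_sub_g_pow_ne_zero [Fact p.Prime] {ι : Type*} [DecidableEq ι] {k : ℕ} (hk : k < p)
    (S : Finset ι) (w : ι → Fin n → ZMod p) (hw : LinearIndependent (ZMod p) w) :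
    ∏ i ∈ S, (1 - g (w i) : GroupRing p n) ^ k ≠ 0 := by
  suffices h : (∏ i ∈ S, (1 - g (w i) : GroupRing p n) ^ k).coeff 0 = 1 by
    intro h0
    rw [h0] at h
    simp at h
  induction S using Finset.induction_on with
  | empty => simp [AddMonoidAlgebra.one_def]
  | insert a S ha ih =>
    rw [Finset.prod_insert ha, coeff_one_sub_g_pow_mul, Finset.sum_eq_single 0]
    · simpa using ih
    -- A nonzero term with `0 < i ≤ k` would give a relation `i w_a + ∑ s_j w_j = 0`, whose
    -- coefficient `i` is nonzero mod `p`.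
    · intro i hi hi0
      by_contra hne
      obtain ⟨s, -, hsum⟩ := exists_eq_sum_of_coeff_prod_ne_zero k S w _ (right_ne_zero_of_mul hne)
      have h0 : ∑ j ∈ insert a S, (if j = a then (i : ZMod p) else s j) • w j = 0 := by
        rw [Finset.sum_insert ha, if_pos rfl, Finset.sum_congr rfl (g := fun j => s j • w j)]
        · rw [← hsum, Nat.cast_smul_eq_nsmul]
          simp
        · intro j hj
          rw [if_neg (by rintro rfl; exact ha hj), Nat.cast_smul_eq_nsmul]
      have := linearIndependent_iff'.mp hw _ _ h0 a (Finset.mem_insert_self _ _)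
      rw [if_pos rfl, ZMod.natCast_eq_zero_iff] at this
      have := Nat.le_of_dvd (Nat.pos_of_ne_zero hi0) this
      have := Finset.mem_range.mp hi
      omega
    · simp

/-- If `∏_{i ∈ S} (1 - g^{v_i})^k` vanishes but ceases to do so without the factor of index `j`,
then the set of all `∑ z_i v_i`, `z_i ∈ A_i`, is invariant under translations along `v_j`. -/
theorem exists_sum_smul_eq_add_smul [Fact p.Prime] {ι : Type*} [DecidableEq ι] {k : ℕ}
    {S : Finset ι} {v : ι → Fin n → ZMod p} {A : ι → Finset (ZMod p)} {j : ι} (hj : j ∈ S)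
    (h0 : ∏ i ∈ S, (1 - g (v i) : GroupRing p n) ^ k = 0)
    (h1 : ∏ i ∈ S.erase j, (1 - g (v i) : GroupRing p n) ^ k ≠ 0)
    (hA : ∀ i ∈ S, IsSType k (A i)) (hAj : IsNType k (A j))
    {z : ι → ZMod p} (hz : ∀ i ∈ S, z i ∈ A i) (t : ZMod p) :
    ∃ z' : ι → ZMod p, (∀ i ∈ S, z' i ∈ A i) ∧
      ∑ i ∈ S, z' i • v i = ∑ i ∈ S, z i • v i + t • v j := by
  by_cases ht : z j + t ∈ A j
  · refine ⟨Function.update z j (z j + t), fun i hi => ?_, ?_⟩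
    · by_cases hij : i = j
      · subst hij
        simpa using ht
      · simpa [hij] using hz i hi
    · rw [← Finset.add_sum_erase _ _ hj, ← Finset.add_sum_erase _ (fun i => z i • v i) hj,
        Function.update_self, Finset.sum_congr rfl (g := fun i => z i • v i)]
      · rw [add_smul]
        abel
      · intro i hi
        rw [Function.update_of_ne (Finset.ne_of_mem_erase hi)]
  -- Now `z j + t` lies outside `A j`, but `N_k` allows a correction by `m d` with `1 ≤ m ≤ k`; the
  -- `S_k` progressions around the other `z i` must absorb `m d v_j`.
  obtain ⟨d, hd, hdA⟩ := hAj.2 _ ht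
  have hS : ∀ i : ι, ∃ δ : ZMod p, i ∈ S → δ ≠ 0 ∧
      ∀ m : ℤ, -(k : ℤ) ≤ m → m ≤ (k : ℤ) → z i + (m : ZMod p) * δ ∈ A i := by
    intro i
    by_cases hi : i ∈ S
    · obtain ⟨δ, h⟩ := hA i hi (z i) (hz i hi)
      exact ⟨δ, fun _ => h⟩
    · exact ⟨0, fun h => absurd h hi⟩
  choose δ hδ using hS
  set Θ : GroupRing p n := ∏ i ∈ S.erase j, (1 - g (δ i • v i)) ^ k with hΘ
  have hΘ0 : Θ ≠ 0 := by
    intro h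
    refine h1 (zero_dvd_iff.mp (h ▸ Finset.prod_dvd_prod_of_dvd _ _ fun i hi => ?_))
    exact pow_dvd_pow_of_dvd (one_sub_g_smul_dvd (hδ i (Finset.mem_of_mem_erase hi)).1 _) _
  have hΘj : (1 - g (d • v j)) ^ k * Θ = 0 := by
    rw [← zero_dvd_iff, ← h0, ← Finset.mul_prod_erase _ _ hj]
    refine mul_dvd_mul (pow_dvd_pow_of_dvd (one_sub_g_dvd_smul _ _) _)
      (Finset.prod_dvd_prod_of_dvd _ _ fun i _ => ?_)
    exact pow_dvd_pow_of_dvd (one_sub_g_dvd_smul _ _) _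
  obtain ⟨u, hu⟩ : ∃ u, Θ.coeff u ≠ 0 := by
    by_contra! h
    exact hΘ0 (AddMonoidAlgebra.ext (Finsupp.ext h))
  -- The coefficient of `(1 - g (d • v j))^k * Θ` at `u` is zero, so the term `Θ.coeff u` must be
  -- cancelled: some other support point lies at `u - m d v_j`.
  obtain ⟨m, hm, hm0, hum⟩ : ∃ m : ℕ, m ≤ k ∧ m ≠ 0 ∧ Θ.coeff (u - m • (d • v j)) ≠ 0 := by
    by_contra! h
    have hc := coeff_one_sub_g_pow_mul k (d • v j) u Θ
    rw [hΘj, Finset.sum_eq_single 0] at hc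
    · simp [hu.symm] at hc
    · intro i hi hi0
      rw [h i (Nat.lt_succ_iff.mp (Finset.mem_range.mp hi)) hi0, mul_zero]
    · simp
  obtain ⟨s, hs, hsu⟩ := exists_eq_sum_of_coeff_prod_ne_zero k _ _ _ hu
  obtain ⟨s', hs', hsu'⟩ := exists_eq_sum_of_coeff_prod_ne_zero k _ _ _ hum
  -- Subtracting the two support expansions gives `m d v_j + ∑ (s'_i - s_i) δ_i v_i = 0` with `|s'_i
  -- - s_i| ≤ k`; adding this relation changes no sum and lands every coefficient in its set.
  refine ⟨Function.update (fun i => z i + (((s' i : ℤ) - s i : ℤ) : ZMod p) * δ i) j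
    (z j + t + ((m : ℤ) : ZMod p) * d), fun i hi => ?_, ?_⟩
  · by_cases hij : i = j
    · subst hij
      rw [Function.update_self]
      exact hdA m (by omega) (by omega)
    · rw [Function.update_of_ne hij]
      have h1 := hs i
      have h2 := hs' i
      exact (hδ i hi).2 _ (by omega) (by omega)
  · rw [← Finset.add_sum_erase _ _ hj, ← Finset.add_sum_erase _ (fun i => z i • v i) hj,
      Function.update_self,
      Finset.sum_congr rfl (g := fun i => z i • v i + (s' i • δ i • v i - s i • δ i • v i))]
    · rw [Finset.sum_add_distrib, Finset.sum_sub_distrib, ← hsu, ← hsu', add_smul, add_smul,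
        mul_smul, Int.cast_natCast, Nat.cast_smul_eq_nsmul]
      abel
    · intro i hi
      rw [Function.update_of_ne (Finset.ne_of_mem_erase hi), add_smul, mul_smul, Int.cast_sub,
        sub_smul, Int.cast_natCast, Int.cast_natCast, Nat.cast_smul_eq_nsmul,
        Nat.cast_smul_eq_nsmul]

end GroupRing

/-! ### Counting modulo coordinate subspaces, and the nonvanishing theorem -/

/-- If `w_1, …, w_n` span `W`, then some nonempty fiber of `y ↦ ∑ y_i w_i` on the box `B^n` has at
most `|B|^(n - dim W)` elements. -/
theorem exists_card_fiber_sum_smul_le {K W : Type*} [Field K] [DecidableEq K] [AddCommGroup W]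
    [Module K W] [DecidableEq W] {n m : ℕ} (w : Fin n → W)
    (hw : Submodule.span K (Set.range w) = ⊤) (hm : Module.finrank K W + m = n)
    {B : Finset K} (hB : B.Nonempty) :
    ∃ y₀ ∈ Fintype.piFinset (fun _ : Fin n => B),
      ((Fintype.piFinset fun _ : Fin n => B).filter
        fun y => ∑ i, y i • w i = ∑ i, y₀ i • w i).card ≤ B.card ^ m := by
  obtain ⟨κ, a, ha, hspan, hli⟩ := exists_linearIndependent' K w
  have : Finite κ := Finite.of_injective a ha
  have := Fintype.ofFinite κ
  have hκ : Fintype.card κ = Module.finrank K W :=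
    (Module.finrank_eq_card_basis (Module.Basis.mk hli (by rw [hspan, hw]))).symm
  classical
  obtain ⟨b, hb⟩ := hB
  -- Only the coordinates of a basis extracted from `w` vary; the others are frozen at `b`. This
  -- already produces `|B|^(dim W)` distinct sums, so an average fiber is small enough.
  let ext : (κ → K) → Fin n → K := fun z => Function.extend a z fun _ => b
  have hext_mem : ∀ z ∈ Fintype.piFinset (fun _ : κ => B),
      ext z ∈ Fintype.piFinset (fun _ : Fin n => B) := by
    intro z hz
    rw [Fintype.mem_piFinset] at hz ⊢
    intro i
    by_cases hi : ∃ c, a c = i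
    · obtain ⟨c, rfl⟩ := hi
      simpa [ext, ha.extend_apply] using hz c
    · simpa [ext, Function.extend_apply' _ _ _ hi] using hb
  have hext_sum : ∀ z, ∑ i, ext z i • w i =
      ∑ c, z c • w (a c) + ∑ i ∈ (Finset.univ.image a)ᶜ, b • w i := by
    intro z
    rw [← Finset.sum_add_sum_compl (Finset.univ.image a), Finset.sum_image ha.injOn]
    congr 1
    · exact Finset.sum_congr rfl fun c _ => by simp [ext, ha.extend_apply]
    · refine Finset.sum_congr rfl fun i hi => ?_
      have hi : ¬ ∃ c, a c = i := by simpa using hi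
      simp [ext, Function.extend_apply' _ _ _ hi]
  have himage : B.card ^ Module.finrank K W ≤
      ((Fintype.piFinset fun _ : Fin n => B).image fun y => ∑ i, y i • w i).card := by
    have hc : (Fintype.piFinset fun _ : κ => B).card = B.card ^ Module.finrank K W := by
      rw [Fintype.card_piFinset, Finset.prod_const, Finset.card_univ, hκ]
    rw [← hc]
    refine Finset.card_le_card_of_injOn (fun z => ∑ i, ext z i • w i)
      (fun z hz => Finset.mem_image_of_mem _ (hext_mem z hz)) fun z _ z' _ h => ?_
    simp only [hext_sum, add_left_inj] at h
    funext c
    refine sub_eq_zero.mp (Fintype.linearIndependent_iff.mp hli (fun c => z c - z' c) ?_ c)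
    simp only [sub_smul, Finset.sum_sub_distrib, Function.comp_apply, h, sub_self]
  have hne : (Fintype.piFinset fun _ : Fin n => B).Nonempty :=
    Fintype.piFinset_nonempty.mpr fun _ => ⟨b, hb⟩
  obtain ⟨x, hx, hcard⟩ := Finset.exists_card_fiber_le_of_card_le_mul
    (s := Fintype.piFinset fun _ : Fin n => B) (f := fun y => ∑ i, y i • w i) (n := B.card ^ m)
    (hne.image _) (by
      rw [Fintype.card_piFinset_const]
      calc B.card ^ n = B.card ^ Module.finrank K W * B.card ^ m := by rw [← pow_add, hm]
        _ ≤ _ := Nat.mul_le_mul_right _ himage)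
  obtain ⟨y₀, hy₀, rfl⟩ := Finset.mem_image.mp hx
  exact ⟨y₀, hy₀, hcard⟩

/-- The rows of an invertible matrix, restricted to a set of columns, span. -/
theorem span_range_row_restrict {K : Type*} [Field K] {n : ℕ} {M : Matrix (Fin n) (Fin n) K}
    (hM : M.det ≠ 0) (J : Finset (Fin n)) :
    Submodule.span K (Set.range fun j => fun i : {i // i ∉ J} => M j i) = ⊤ := by
  have hli : LinearIndependent K M.row :=
    Matrix.linearIndependent_rows_iff_isUnit.mpr
      ((Matrix.isUnit_iff_isUnit_det M).mpr (isUnit_iff_ne_zero.mpr hM))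
  have hspan := hli.span_eq_top_of_card_eq_finrank' (by simp)
  have hrange : (Set.range fun j => fun i : {i // i ∉ J} => M j i) =
      LinearMap.funLeft K K (Subtype.val : {i // i ∉ J} → Fin n) '' Set.range M.row := by
    rw [← Set.range_comp]
    rfl
  rw [hrange, Submodule.span_image, hspan, Submodule.map_top, LinearMap.range_eq_top]
  exact LinearMap.funLeft_surjective_of_injective _ _ _ Subtype.val_injective

/-- The main nonvanishing result: `A` of type `N_k`, `B` of type `S_k` and `(|A| |B|)^r < p` give
`∏ (1 - g^{e_i})^{kr} ∏ (1 - g^{a_i})^{kr} ≠ 0`. -/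
theorem prod_mul_prod_ne_zero {p n k r : ℕ} [Fact p.Prime] {A B : Finset (ZMod p)}
    (hA : A.Nonempty) (hAN : IsNType k A) (hB : B.Nonempty) (hBS : IsSType k B)
    (hkr : k * r < p) (hcard : (A.card * B.card) ^ r < p)
    (M : Matrix (Fin n) (Fin n) (ZMod p)) (hM : M.det ≠ 0) :
    (∏ i : Fin n, (1 - g (Pi.single i 1 : Fin n → ZMod p)) ^ (k * r)) *
      (∏ i : Fin n, (1 - g (M.row i)) ^ (k * r)) ≠ (0 : GroupRing p n) := by
  classical
  intro hzero
  -- Each factor with exponent `k * r` is split into `r` factors with exponent `k`.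
  let ι := (Fin n × Fin r) ⊕ (Fin n × Fin r)
  let v : ι → Fin n → ZMod p := Sum.elim (fun x => Pi.single x.1 1) (fun x => M.row x.1)
  let A' : ι → Finset (ZMod p) := Sum.elim (fun _ => A) (fun _ => B)
  let S : Finset (Fin n × Fin r) → Finset ι := fun C => C.disjSum Finset.univ
  have hinl : ∀ C j, (Sum.inl j : ι) ∈ S C ↔ j ∈ C := fun _ _ => Finset.inl_mem_disjSum
  have hinr : ∀ C j, (Sum.inr j : ι) ∈ S C := fun _ j =>
    Finset.inr_mem_disjSum.mpr (Finset.mem_univ j)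
  have hprod : ∀ u : Fin n → Fin n → ZMod p,
      ∏ x : Fin n × Fin r, (1 - g (u x.1) : GroupRing p n) ^ k =
        ∏ i, (1 - g (u i)) ^ (k * r) := by
    intro u
    rw [Fintype.prod_prod_type]
    simp [pow_mul]
  have hex : ∃ C, ∏ i ∈ S C, (1 - g (v i) : GroupRing p n) ^ k = 0 := by
    refine ⟨Finset.univ, ?_⟩
    rw [Finset.prod_disjSum]
    simp only [v, Sum.elim_inl, Sum.elim_inr]
    rw [hprod fun i => Pi.single i 1, hprod, hzero]
  obtain ⟨C, hC, hCmin⟩ := exists_minimal_of_wellFoundedLT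
    (fun C => ∏ i ∈ S C, (1 - g (v i) : GroupRing p n) ^ k = 0) hex
  have hCne : C.Nonempty := by
    rw [Finset.nonempty_iff_ne_empty]
    rintro rfl
    rw [Finset.prod_disjSum, Finset.prod_empty, one_mul] at hC
    simp only [v, Sum.elim_inr] at hC
    rw [hprod] at hC
    exact prod_one_sub_g_pow_ne_zero hkr _ _ (Matrix.linearIndependent_rows_iff_isUnit.mpr
      ((Matrix.isUnit_iff_isUnit_det M).mpr (isUnit_iff_ne_zero.mpr hM))) hC
  have herase : ∀ j ∈ C,
      ∏ i ∈ (S C).erase (Sum.inl j), (1 - g (v i) : GroupRing p n) ^ k ≠ 0 := by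
    intro j hj h
    have hS : (S C).erase (Sum.inl j) = S (C.erase j) := by
      ext x
      cases x with
      | inl x => rw [Finset.mem_erase, hinl, hinl, Finset.mem_erase, Sum.inl_injective.ne_iff]
      | inr x => simp only [Finset.mem_erase, hinr, ne_eq, reduceCtorEq, not_false_eq_true, and_self]
    rw [hS] at h
    exact (Finset.notMem_erase j C) (hCmin h (Finset.erase_subset _ _) hj)
  have hA' : ∀ i ∈ S C, IsSType k (A' i) := by
    rintro (i | i) _
    · exact hAN.1
    · exact hBS
  let J : Finset (Fin n) := C.image Prod.fst
  have hclosed : ∀ (T : Finset (Fin n)), T ⊆ J → ∀ (w : Fin n → ZMod p) (z : ι → ZMod p),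
      (∀ i ∈ S C, z i ∈ A' i) → ∃ z' : ι → ZMod p, (∀ i ∈ S C, z' i ∈ A' i) ∧
        ∑ i ∈ S C, z' i • v i = ∑ i ∈ S C, z i • v i + ∑ i ∈ T, w i • Pi.single i 1 := by
    intro T
    induction T using Finset.induction_on with
    | empty => exact fun _ w z hz => ⟨z, hz, by simp⟩
    | insert t T ht ih =>
      intro hT w z hz
      obtain ⟨z₁, hz₁, hsum₁⟩ := ih (fun i hi => hT (Finset.mem_insert_of_mem hi)) w z hz
      obtain ⟨⟨t', l⟩, hj, rfl⟩ := Finset.mem_image.mp (hT (Finset.mem_insert_self t T))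
      obtain ⟨z₂, hz₂, hsum₂⟩ := exists_sum_smul_eq_add_smul (j := Sum.inl (t', l))
        ((hinl _ _).mpr hj) hC (herase _ hj) hA' hAN hz₁ (w t')
      refine ⟨z₂, hz₂, ?_⟩
      rw [hsum₂, hsum₁, Finset.sum_insert ht]
      simp only [v, Sum.elim_inl]
      abel
  -- The `r`-fold sumset of `B`.
  let B' : Finset (ZMod p) := (Fintype.piFinset fun _ : Fin r => B).image fun y => ∑ l, y l
  have hB' : B'.Nonempty := (Fintype.piFinset_nonempty.mpr fun _ => hB).image _
  have hB'card : B'.card ≤ B.card ^ r := Finset.card_image_le.trans (by simp)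
  have hJn : Module.finrank (ZMod p) ({i // i ∉ J} → ZMod p) + J.card = n := by
    rw [Module.finrank_fintype_fun_eq_card, Fintype.card_subtype_compl, Fintype.card_fin,
      Fintype.card_coe]
    exact Nat.sub_add_cancel (by simpa using Finset.card_le_univ J)
  obtain ⟨y₀, hy₀, hfib⟩ := exists_card_fiber_sum_smul_le _ (span_range_row_restrict hM J) hJn hB'
  set Y := (Fintype.piFinset fun _ : Fin n => B').filter fun y =>
    ∑ j, y j • (fun i : {i // i ∉ J} => M j i) = ∑ j, y₀ j • (fun i : {i // i ∉ J} => M j i)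
    with hY
  have hsplit : ∀ z : ι → ZMod p, ∑ i ∈ S C, z i • v i =
      ∑ x : C, z (Sum.inl x) • (Pi.single x.1.1 1 : Fin n → ZMod p) +
        ∑ j, (∑ l, z (Sum.inr (j, l))) • M.row j := by
    intro z
    rw [Finset.sum_disjSum, Fintype.sum_prod_type]
    simp only [v, Sum.elim_inl, Sum.elim_inr, Finset.sum_smul]
    rw [Finset.sum_coe_sort C fun x => z (Sum.inl x) • (Pi.single x.1 1 : Fin n → ZMod p)]
  have hy₀' : ∀ j, ∃ y : Fin r → ZMod p, (∀ l, y l ∈ B) ∧ ∑ l, y l = y₀ j := by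
    intro j
    simpa [B'] using Fintype.mem_piFinset.mp hy₀ j
  choose b hb hbsum using hy₀'
  obtain ⟨a, ha⟩ := hA
  let z₀ : ι → ZMod p := Sum.elim (fun _ => a) fun x => b x.1 x.2
  have hz₀ : ∀ i ∈ S C, z₀ i ∈ A' i := by
    rintro (i | i) _
    · exact ha
    · exact hb _ _
  let E : (J → ZMod p) → Fin n → ZMod p := fun w i => if h : i ∈ J then w ⟨i, h⟩ else 0
  have hE : ∀ w, ∃ z' : ι → ZMod p, (∀ i ∈ S C, z' i ∈ A' i) ∧
      ∑ i ∈ S C, z' i • v i = ∑ i ∈ S C, z₀ i • v i + E w := by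
    intro w
    obtain ⟨z', hz', hsum⟩ := hclosed J subset_rfl (E w) z₀ hz₀
    refine ⟨z', hz', ?_⟩
    rw [hsum]
    congr 1
    ext i
    simp only [Finset.sum_apply, Pi.smul_apply, Pi.single_apply, smul_eq_mul, mul_ite, mul_one,
      mul_zero, Finset.sum_ite_eq]
    by_cases hi : i ∈ J <;> simp [hi, E]
  choose ζ hζ hζsum using hE
  -- A translate by `E w` is determined by its coefficients on `C` and its row sums. Outside `J` the
  -- unit vectors contribute nothing, so the row sums stay in the fiber of `y₀`.
  have hmain : (Finset.univ : Finset (J → ZMod p)).card ≤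
      ((Fintype.piFinset fun _ : C => A) ×ˢ Y).card := by
    refine Finset.card_le_card_of_injOn
      (fun w => (fun x => ζ w (Sum.inl x), fun j => ∑ l, ζ w (Sum.inr (j, l)))) ?_ ?_
    · intro w _
      rw [Finset.mem_coe, Finset.mem_product]
      refine ⟨Fintype.mem_piFinset.mpr fun x => hζ w _ ((hinl _ _).mpr x.2), ?_⟩
      rw [hY, Finset.mem_filter]
      constructor
      · refine Fintype.mem_piFinset.mpr fun j => Finset.mem_image.mpr
          ⟨fun l => ζ w (Sum.inr (j, l)), Fintype.mem_piFinset.mpr fun l => ?_, rfl⟩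
        exact hζ w (Sum.inr (j, l)) (hinr _ _)
      · have hx : ∀ (c : C → ZMod p) (i : Fin n), i ∉ J →
            (∑ x : C, c x • (Pi.single x.1.1 1 : Fin n → ZMod p)) i = 0 := by
          intro c i hi
          rw [Finset.sum_apply]
          refine Finset.sum_eq_zero fun x _ => ?_
          have : i ≠ x.1.1 := by
            rintro rfl
            exact hi (Finset.mem_image_of_mem _ x.2)
          simp [this]
        ext ⟨i, hi⟩
        have h := congrFun (hζsum w) i
        rw [hsplit, hsplit, Pi.add_apply, Pi.add_apply, Pi.add_apply, hx _ i hi, hx _ i hi] at h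
        simpa [E, hi, z₀, hbsum, Finset.sum_apply] using h
    · intro w _ w' _ h
      obtain ⟨h1, h2⟩ := Prod.ext_iff.mp h
      have hEE : E w = E w' := by
        refine add_left_cancel (a := ∑ i ∈ S C, z₀ i • v i) ?_
        rw [← hζsum w, ← hζsum w', hsplit, hsplit]
        congr 1
        · exact Finset.sum_congr rfl fun x _ => congrArg (· • _) (congrFun h1 x)
        · exact Finset.sum_congr rfl fun j _ => congrArg (· • _) (congrFun h2 j)
      funext ⟨i, hi⟩
      simpa [E, hi] using congrFun hEE i
  have hCJ : C.card ≤ r * J.card := by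
    have hsub : C ⊆ J ×ˢ (Finset.univ : Finset (Fin r)) := fun x hx =>
      Finset.mem_product.mpr ⟨Finset.mem_image_of_mem _ hx, Finset.mem_univ _⟩
    simpa [mul_comm] using Finset.card_le_card hsub
  have hJpos : J.card ≠ 0 := (hCne.image _).card_pos.ne'
  rw [Finset.card_univ, Fintype.card_fun, ZMod.card, Fintype.card_coe, Finset.card_product,
    Fintype.card_piFinset, Finset.prod_const, Finset.card_univ, Fintype.card_coe] at hmain
  refine absurd hmain (not_le.mpr ?_)
  calc A.card ^ C.card * Y.card ≤ A.card ^ (r * J.card) * (B.card ^ r) ^ J.card :=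
        Nat.mul_le_mul (Nat.pow_le_pow_right (Finset.card_pos.mpr ⟨a, ha⟩) hCJ)
          (hfib.trans (Nat.pow_le_pow_left hB'card _))
    _ = ((A.card * B.card) ^ r) ^ J.card := by rw [pow_mul, ← mul_pow, ← mul_pow]
    _ < p ^ J.card := Nat.pow_lt_pow_left hcard hJpos

/-! ### From nonvanishing to avoidance, through characters -/

section Covering

variable {p n : ℕ} [Fact p.Prime]

/-- Fourier inversion: an element of the group ring over a domain killed by all characters
`v ↦ ψ (v ⬝ x)`, `ψ` nontrivial, is zero. -/
theorem eq_zero_of_forall_lift_eq_zero {R : Type*} [CommRing R] [IsDomain R] [CharZero R]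
    {ψ : AddChar (ZMod p) R} (hψ : ψ.IsPrimitive) (F : AddMonoidAlgebra R (Fin n → ZMod p))
    (hF : ∀ x : Fin n → ZMod p, F.coeff.sum (fun v c => c * ψ (v ⬝ᵥ x)) = 0) : F = 0 := by
  classical
  have horth : ∀ u : Fin n → ZMod p, u ≠ 0 → ∑ x : Fin n → ZMod p, ψ (u ⬝ᵥ x) = 0 := by
    intro u hu
    obtain ⟨i, hi⟩ := Function.ne_iff.mp hu
    let χ : AddChar (Fin n → ZMod p) R :=
      ψ.compAddMonoidHom (AddMonoidHom.mk' (fun x => u ⬝ᵥ x) fun x y => dotProduct_add u x y)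
    have hχ : χ ≠ 0 := by
      intro h
      apply hψ hi
      ext c
      have := DFunLike.congr_fun h (Pi.single i c)
      simpa [χ] using this
    have := AddChar.sum_eq_ite χ
    rw [if_neg hχ] at this
    simpa [χ] using this
  refine AddMonoidAlgebra.ext (Finsupp.ext fun w => ?_)
  -- Averaging against `ψ (-w ⬝ᵥ x)` isolates `p^n` times the coefficient at `w`.
  have h : ∑ x : Fin n → ZMod p, ψ (-w ⬝ᵥ x) * F.coeff.sum (fun v c => c * ψ (v ⬝ᵥ x)) = 0 := by
    simp [hF]
  have hsum : ∀ x : Fin n → ZMod p, F.coeff.sum (fun v c => c * ψ (v ⬝ᵥ x)) =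
      ∑ v, F.coeff v * ψ (v ⬝ᵥ x) :=
    fun x => Finsupp.sum_fintype _ _ fun _ => zero_mul _
  simp only [hsum, Finset.mul_sum] at h
  rw [Finset.sum_comm, Finset.sum_eq_single w] at h
  · have hx : ∀ x : Fin n → ZMod p,
        ψ (-w ⬝ᵥ x) * (F.coeff w * ψ (w ⬝ᵥ x)) = F.coeff w := by
      intro x
      rw [mul_left_comm, ← AddChar.map_add_eq_mul, ← add_dotProduct]
      simp
    simp only [hx, Finset.sum_const, nsmul_eq_mul] at h
    refine (mul_eq_zero.mp h).resolve_left ?_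
    simp [(Fact.out : p.Prime).ne_zero]
  · intro v _ hv
    have hx : ∀ x : Fin n → ZMod p,
        ψ (-w ⬝ᵥ x) * (F.coeff v * ψ (v ⬝ᵥ x)) = F.coeff v * ψ ((v - w) ⬝ᵥ x) := by
      intro x
      rw [mul_left_comm, ← AddChar.map_add_eq_mul, ← add_dotProduct, neg_add_eq_sub]
    simp only [hx, ← Finset.mul_sum]
    rw [horth _ (sub_ne_zero.mpr hv), mul_zero]
  · simp

/-- If the hyperplanes `v_i ⬝ x = c_i` cover `𝔽_p^n`, then `∏ (1 - g^{v_i}) = 0`. -/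
theorem prod_one_sub_g_eq_zero_of_cover {ι : Type*} [Fintype ι] (v : ι → Fin n → ZMod p)
    (c : ι → ZMod p) (hcover : ∀ x : Fin n → ZMod p, ∃ i, v i ⬝ᵥ x = c i) :
    ∏ i, (1 - g (v i) : GroupRing p n) = 0 := by
  have hp : p.Prime := Fact.out
  let Φ : Polynomial ℤ := Polynomial.cyclotomic p ℤ
  let R := AdjoinRoot Φ
  have hirr : Irreducible Φ := Polynomial.cyclotomic.irreducible hp.pos
  have hprime : Prime Φ := hirr.prime
  have : IsDomain R := AdjoinRoot.isDomain_of_prime hprime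
  have : CharZero R := by
    have hinj : Function.Injective (AdjoinRoot.of Φ) :=
      AdjoinRoot.of.injective_of_degree_ne_zero
        (by rw [Polynomial.degree_cyclotomic]; exact_mod_cast (Nat.totient_pos.mpr hp.pos).ne')
    exact charZero_of_injective_ringHom hinj
  let ζ : R := AdjoinRoot.root Φ
  have hζ : IsPrimitiveRoot ζ p := by
    rw [← Polynomial.isRoot_cyclotomic_iff, Polynomial.IsRoot.def,
      ← Polynomial.map_cyclotomic_int p R, Polynomial.eval_map,
      RingHom.ext_int (Int.castRingHom R) (AdjoinRoot.of Φ)]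
    exact AdjoinRoot.eval₂_root Φ
  let ψ : AddChar (ZMod p) R := AddChar.zmodChar p hζ.pow_eq_one
  have hψ : ψ.IsPrimitive := AddChar.zmodChar_primitive_of_primitive_root p hζ
  -- Sending `ζ` to `1` is legitimate because the cyclotomic polynomial takes the value `p` at `1`.
  let π : R →+* ZMod p := AdjoinRoot.lift (Int.castRingHom _) 1 (by
    rw [← Polynomial.eval_map, Polynomial.map_cyclotomic, Polynomial.eval_one_cyclotomic_prime]
    simp)
  have hπ : ∀ a, π (ψ a) = 1 := by
    intro a
    have hroot : π ζ = 1 := AdjoinRoot.lift_root _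
    rw [AddChar.zmodChar_apply, map_pow, hroot, one_pow]
  -- The character at `x` sends factor `i` to `1 - ψ (v i ⬝ᵥ x - c i)`, which is zero exactly when
  -- `x` lies on hyperplane `i`.
  let F : AddMonoidAlgebra R (Fin n → ZMod p) :=
    ∏ i, (1 - AddMonoidAlgebra.single (v i) (ψ (-c i)))
  have hF : F = 0 := by
    refine eq_zero_of_forall_lift_eq_zero hψ F fun x => ?_
    let χ : Multiplicative (Fin n → ZMod p) →* R :=
      { toFun := fun w => ψ (w.toAdd ⬝ᵥ x)
        map_one' := by simp
        map_mul' := fun a b => by simp [add_dotProduct, AddChar.map_add_eq_mul] }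
    have hχ : ∀ G : AddMonoidAlgebra R (Fin n → ZMod p),
        AddMonoidAlgebra.lift R R (Fin n → ZMod p) χ G =
          G.coeff.sum (fun w a => a * ψ (w ⬝ᵥ x)) := by
      intro G
      rw [AddMonoidAlgebra.lift_apply]
      rfl
    rw [← hχ, map_prod]
    obtain ⟨i, hi⟩ := hcover x
    refine Finset.prod_eq_zero (Finset.mem_univ i) ?_
    rw [map_sub, map_one, AddMonoidAlgebra.lift_single, smul_eq_mul, sub_eq_zero]
    change 1 = ψ (-c i) * ψ (v i ⬝ᵥ x)
    rw [hi, ← AddChar.map_add_eq_mul]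
    simp
  have := congrArg (AddMonoidAlgebra.mapRingHom (Fin n → ZMod p) π) hF
  rw [map_zero, map_prod] at this
  rw [← this]
  refine Finset.prod_congr rfl fun i _ => ?_
  rw [map_sub, map_one, AddMonoidAlgebra.mapRingHom_single, hπ]
  rfl

/-- Nonvanishing of `∏ (1 - g^{e_i})^k ∏ (1 - g^{a_i})^k` allows one to avoid `k` prescribed values
in each coordinate of `x` and of `M x`. -/
theorem exists_avoiding_of_prod_ne_zero {k : ℕ} (M : Matrix (Fin n) (Fin n) (ZMod p))
    (h : (∏ i : Fin n, (1 - g (Pi.single i 1 : Fin n → ZMod p)) ^ k) *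
      (∏ i : Fin n, (1 - g (M.row i)) ^ k) ≠ (0 : GroupRing p n))
    (c d : Fin n → Fin k → ZMod p) :
    ∃ x : Fin n → ZMod p, (∀ i l, x i ≠ c i l) ∧ (∀ i l, M.mulVec x i ≠ d i l) := by
  by_contra hcon
  apply h
  have hzero := prod_one_sub_g_eq_zero_of_cover (p := p) (n := n)
    (ι := (Fin n × Fin k) ⊕ (Fin n × Fin k))
    (Sum.elim (fun x => Pi.single x.1 1) fun x => M.row x.1)
    (Sum.elim (fun x => c x.1 x.2) fun x => d x.1 x.2) (by
      intro x
      by_contra hx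
      push Not at hx
      refine hcon ⟨x, fun i l => ?_, fun i l => hx (Sum.inr (i, l))⟩
      simpa using hx (Sum.inl (i, l)))
  rw [Fintype.prod_sum_type, Fintype.prod_prod_type, Fintype.prod_prod_type] at hzero
  simpa using hzero

end Covering

/-! ### Small sets of type `S_1` and numerical estimates -/

section BalancedSets

variable {p : ℕ}

theorem isSType_one_of_forall_exists {A : Finset (ZMod p)}
    (h : ∀ a ∈ A, ∃ b ∈ A, b ≠ a ∧ 2 * a - b ∈ A) : IsSType 1 A := by
  intro a ha
  obtain ⟨b, hb, hne, hc⟩ := h a ha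
  refine ⟨b - a, sub_ne_zero.mpr hne, fun i h1 h2 => ?_⟩
  obtain rfl | rfl | rfl : i = -1 ∨ i = 0 ∨ i = 1 := by
    norm_num at h1 h2
    omega
  · have : a + ((-1 : ℤ) : ZMod p) * (b - a) = 2 * a - b := by
      push_cast
      ring
    rwa [this]
  · simpa using ha
  · simpa using hb

/-- For `k = 1` the outer condition asks only for one element of `A` to step to. -/
theorem IsSType.isNType_one {A : Finset (ZMod p)} (h : IsSType 1 A) (hA : A.Nonempty) :
    IsNType 1 A := by
  refine ⟨h, fun a ha => ?_⟩
  obtain ⟨b, hb⟩ := hA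
  refine ⟨b - a, sub_ne_zero.mpr (by rintro rfl; exact ha hb), fun i h1 h2 => ?_⟩
  obtain rfl : i = 1 := le_antisymm (by simpa using h2) h1
  simpa using hb

theorem isNType_univ (k : ℕ) [Fact p.Prime] : IsNType k (Finset.univ : Finset (ZMod p)) :=
  ⟨fun _ _ => ⟨1, one_ne_zero, fun _ _ _ => Finset.mem_univ _⟩,
    fun _ _ => ⟨1, one_ne_zero, fun _ _ _ => Finset.mem_univ _⟩⟩

/-- The residues `0` and `±⌊p / 2^j⌋`, `1 ≤ j ≤ log₂ p`, form a set of type `S_1`. -/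
theorem exists_isSType_one_card_le_log (hp : p.Prime) (hp2 : 2 < p) :
    ∃ A : Finset (ZMod p), A.Nonempty ∧ IsSType 1 A ∧ A.card ≤ 2 * Nat.log 2 p + 1 := by
  have : Fact p.Prime := ⟨hp⟩
  set L := Nat.log 2 p with hL
  let x : ℕ → ZMod p := fun j => ((p / 2 ^ j : ℕ) : ZMod p)
  let X : Finset (ZMod p) := (Finset.Icc 1 L).image x
  let A : Finset (ZMod p) := insert 0 (X ∪ X.image Neg.neg)
  have hL1 : 1 ≤ L := (Nat.le_log_iff_pow_le (by norm_num) (by omega)).mpr (by omega)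
  have hXA : ∀ a ∈ X, a ∈ A := fun a ha =>
    Finset.mem_insert_of_mem (Finset.mem_union_left _ ha)
  have h0 : (0 : ZMod p) ∈ A := Finset.mem_insert_self _ _
  have hneg : ∀ a ∈ A, -a ∈ A := by
    intro a ha
    simp only [A, Finset.mem_insert, Finset.mem_union, Finset.mem_image] at ha ⊢
    rcases ha with rfl | ha | ⟨b, hb, rfl⟩
    · simp
    · exact Or.inr (Or.inr ⟨a, ha, rfl⟩)
    · exact Or.inr (Or.inl (by simpa using hb))
  have h1 : (1 : ZMod p) ∈ X := by
    refine Finset.mem_image.mpr ⟨L, Finset.mem_Icc.mpr ⟨hL1, le_rfl⟩, ?_⟩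
    have : p / 2 ^ L = 1 := Nat.div_eq_of_lt_le (by
      simpa using Nat.pow_log_le_self 2 (by omega : p ≠ 0)) (by
      have := Nat.lt_pow_succ_log_self (b := 2) (by norm_num) p
      rw [pow_succ'] at this
      exact this)
    simp [x, this]
  have hx : ∀ j ∈ Finset.Icc 1 L, x (j - 1) ∈ A := by
    intro j hj
    rw [Finset.mem_Icc] at hj
    by_cases hj1 : j = 1
    · subst hj1
      simpa [x] using h0
    · exact hXA _ (Finset.mem_image_of_mem _ (Finset.mem_Icc.mpr ⟨by omega, by omega⟩))
  -- Halving with remainder, `x i = 2 x (i+1) + ε`, makes `x (i+1)` the midpoint of `x i` and `-ε`,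
  -- where `ε` is `0` or `1`; the chain starts at `x 0 = p = 0` and ends at `1`.
  have hX : ∀ a ∈ X, ∃ b ∈ A, b ≠ a ∧ 2 * a - b ∈ A := by
    intro a ha
    obtain ⟨j, hj, rfl⟩ := Finset.mem_image.mp ha
    obtain ⟨i, rfl⟩ : ∃ i, j = i + 1 := ⟨j - 1, by rw [Finset.mem_Icc] at hj; omega⟩
    have hb := hx _ hj
    rw [Finset.mem_Icc] at hj
    rw [Nat.add_sub_cancel] at hb
    have hhalf : p / 2 ^ (i + 1) = p / 2 ^ i / 2 := by rw [pow_succ, Nat.div_div_eq_div_mul]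
    have hpos : 0 < p / 2 ^ (i + 1) := Nat.div_pos
      ((Nat.pow_le_pow_right (by norm_num) hj.2).trans (Nat.pow_log_le_self 2 (by omega)))
      (by positivity)
    have hle : p / 2 ^ i ≤ p := Nat.div_le_self _ _
    obtain ⟨ε, hε, hdecomp⟩ : ∃ ε : ℕ, (ε = 0 ∨ ε = 1) ∧
        p / 2 ^ i = 2 * (p / 2 ^ (i + 1)) + ε :=
      ⟨p / 2 ^ i % 2, by omega, by omega⟩
    have hcast : x i = 2 * x (i + 1) + ε := by
      simp only [x]
      rw [hdecomp]
      push_cast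
      ring
    -- Equality would make `⌊p / 2^(i+1)⌋ + ε` divisible by `p`, though it lies strictly between `0`
    -- and `p`.
    refine ⟨x i, hb, fun heq => ?_, ?_⟩
    · have hz : ((p / 2 ^ (i + 1) + ε : ℕ) : ZMod p) = 0 := by
        have hxi : x (i + 1) + ε = 0 := by linear_combination hcast.symm.trans heq
        simpa [x] using hxi
      rw [ZMod.natCast_eq_zero_iff] at hz
      have := Nat.le_of_dvd (by omega) hz
      omega
    · have : 2 * x (i + 1) - x i = -(ε : ZMod p) := by rw [hcast]; ring
      rw [this]
      rcases hε with rfl | rfl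
      · simpa using h0
      · simpa using hneg _ (hXA _ h1)
  refine ⟨A, ⟨0, h0⟩, isSType_one_of_forall_exists fun a ha => ?_, ?_⟩
  · rcases Finset.mem_insert.mp ha with rfl | ha
    · exact ⟨1, hXA _ h1, one_ne_zero, by simpa using hneg _ (hXA _ h1)⟩
    rcases Finset.mem_union.mp ha with ha | ha
    · exact hX a ha
    · obtain ⟨a, haX, rfl⟩ := Finset.mem_image.mp ha
      obtain ⟨b, hb, hne, hc⟩ := hX a haX
      refine ⟨-b, hneg _ hb, fun h => hne (neg_injective h), ?_⟩
      have := hneg _ hc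
      rwa [show -(2 * a - b) = 2 * -a - -b by ring] at this
  · have hXcard : X.card ≤ L := Finset.card_image_le.trans (by simp)
    have h1 := Finset.card_insert_le (0 : ZMod p) (X ∪ X.image Neg.neg)
    have h2 := Finset.card_union_le X (X.image Neg.neg)
    have h3 : (X.image Neg.neg).card ≤ X.card := Finset.card_image_le
    change (insert 0 (X ∪ X.image Neg.neg)).card ≤ 2 * L + 1
    omega

theorem exists_isSType_one_of_list {l : List ℕ} (hl : l ≠ []) (hlt : ∀ a ∈ l, a < p)
    (h : ∀ a ∈ l, ∃ b ∈ l, b ≠ a ∧ ∃ c ∈ l, (b + c) % p = 2 * a % p) :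
    ∃ A : Finset (ZMod p), A.Nonempty ∧ IsSType 1 A ∧ A.card ≤ l.length := by
  refine ⟨(l.map (Nat.cast : ℕ → ZMod p)).toFinset, ?_, ?_, ?_⟩
  · simpa using hl
  · refine isSType_one_of_forall_exists fun a ha => ?_
    simp only [List.mem_toFinset, List.mem_map] at ha ⊢
    obtain ⟨a, ha, rfl⟩ := ha
    obtain ⟨b, hb, hne, c, hc, hbc⟩ := h a ha
    refine ⟨b, ⟨b, hb, rfl⟩, fun heq => hne ?_, c, hc, ?_⟩
    · rw [ZMod.natCast_eq_natCast_iff] at heq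
      exact heq.eq_of_lt_of_lt (hlt b hb) (hlt a ha)
    · have : ((b + c : ℕ) : ZMod p) = ((2 * a : ℕ) : ZMod p) :=
        (ZMod.natCast_eq_natCast_iff _ _ _).mpr hbc
      push_cast at this
      linear_combination this
  · simpa using List.toFinset_card_le (l.map (Nat.cast : ℕ → ZMod p))

/-- Sets of type `S_1` of size less than `√p`, for the primes `p` between `61` and `293`, other than
`79`, for which `2 log₂ p + 1 > √p`. -/
def balancedTable : List (ℕ × List ℕ) :=
  [(67, [0, 1, 3, 16, 31, 57, 62, 66]),
   (71, [0, 1, 3, 17, 33, 44, 66, 70]),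
   (73, [0, 1, 3, 11, 21, 42, 68, 72]),
   (83, [0, 1, 2, 6, 13, 43, 66, 81, 82]),
   (89, [0, 1, 2, 7, 39, 64, 76, 86, 88]),
   (97, [0, 1, 2, 7, 42, 69, 84, 94, 96]),
   (101, [0, 1, 2, 8, 15, 31, 62, 97, 100]),
   (103, [0, 1, 2, 8, 16, 56, 79, 99, 102]),
   (107, [0, 1, 2, 7, 27, 54, 94, 104, 106]),
   (109, [0, 1, 2, 8, 47, 78, 93, 105, 108]),
   (113, [0, 1, 2, 8, 48, 81, 97, 109, 112]),
   (127, [0, 1, 2, 8, 32, 63, 111, 123, 126]),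
   (131, [0, 1, 3, 11, 22, 44, 77, 126, 130]),
   (137, [0, 1, 3, 11, 53, 74, 106, 132, 136]),
   (139, [0, 1, 3, 11, 22, 43, 86, 134, 138]),
   (149, [0, 1, 3, 11, 64, 107, 128, 144, 148]),
   (151, [0, 1, 3, 11, 65, 108, 130, 146, 150]),
   (157, [0, 1, 2, 6, 13, 43, 80, 140, 155, 156]),
   (163, [0, 1, 2, 7, 27, 55, 110, 150, 160, 162]),
   (167, [0, 1, 2, 7, 39, 78, 142, 154, 164, 166]),
   (173, [0, 1, 2, 5, 21, 85, 130, 162, 170, 172]),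
   (179, [0, 1, 2, 7, 69, 124, 151, 166, 176, 178]),
   (181, [0, 1, 2, 7, 70, 125, 153, 168, 178, 180]),
   (191, [0, 1, 2, 7, 27, 55, 110, 178, 188, 190]),
   (193, [0, 1, 2, 7, 15, 51, 100, 172, 190, 192]),
   (197, [0, 1, 2, 8, 15, 53, 98, 174, 193, 196]),
   (199, [0, 1, 2, 8, 16, 88, 143, 175, 195, 198]),
   (211, [0, 1, 2, 8, 81, 146, 178, 195, 207, 210]),
   (223, [0, 1, 2, 8, 32, 64, 127, 207, 219, 222]),
   (257, [0, 1, 2, 8, 32, 128, 193, 241, 253, 256]),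
   (263, [0, 1, 3, 11, 53, 137, 200, 232, 258, 262]),
   (269, [0, 1, 3, 11, 22, 119, 194, 237, 264, 268]),
   (271, [0, 1, 3, 19, 38, 46, 73, 145, 231, 270]),
   (277, [0, 1, 3, 11, 107, 192, 235, 256, 272, 276]),
   (281, [0, 1, 3, 11, 65, 130, 238, 260, 276, 280]),
   (283, [0, 1, 2, 6, 22, 45, 88, 175, 273, 281, 282])]

theorem balancedTable_spec : ∀ e ∈ balancedTable, e.2 ≠ [] ∧ (∀ a ∈ e.2, a < e.1) ∧
    (∀ a ∈ e.2, ∃ b ∈ e.2, b ≠ a ∧ ∃ c ∈ e.2, (b + c) % e.1 = 2 * a % e.1) ∧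
    e.2.length * e.2.length < e.1 := by
  decide +kernel

theorem two_mul_add_one_sq_lt_two_pow {L : ℕ} (hL : 9 ≤ L) :
    (2 * L + 1) * (2 * L + 1) < 2 ^ L := by
  induction L, hL using Nat.le_induction with
  | base => norm_num
  | succ L hL ih =>
    rw [pow_succ]
    nlinarith

theorem exists_isSType_one_card_sq_lt (hp : p.Prime) (h61 : 61 < p) (h79 : p ≠ 79) :
    ∃ A : Finset (ZMod p), A.Nonempty ∧ IsSType 1 A ∧ A.card * A.card < p := by
  by_cases hlog : (2 * Nat.log 2 p + 1) * (2 * Nat.log 2 p + 1) < p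
  · obtain ⟨A, hA, hS, hcard⟩ := exists_isSType_one_card_le_log hp (by omega)
    exact ⟨A, hA, hS, (Nat.mul_le_mul hcard hcard).trans_lt hlog⟩
  have hle : Nat.log 2 p < 9 := by
    by_contra! h
    exact hlog ((two_mul_add_one_sq_lt_two_pow h).trans_le (Nat.pow_log_le_self 2 (by omega)))
  have h293 : p < 293 := by
    have : Nat.log 2 p ≤ 8 := by omega
    have : (2 * Nat.log 2 p + 1) * (2 * Nat.log 2 p + 1) ≤ 17 * 17 :=
      Nat.mul_le_mul (by omega) (by omega)
    by_contra! h
    omega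
  -- Here the logarithm is `7`, and `15² = 225 < p` makes the general construction suffice, so the
  -- table skips these primes.
  have hrange : ¬ (226 ≤ p ∧ p < 256) := by
    rintro ⟨h1, h2⟩
    have : Nat.log 2 p = 7 := (Nat.log_eq_iff (by norm_num)).mpr ⟨by omega, by omega⟩
    rw [this] at hlog
    omega
  obtain ⟨e, he, rfl⟩ : ∃ e ∈ balancedTable, e.1 = p := by
    rw [← List.mem_map]
    clear hlog hle
    interval_cases p <;>
      first
        | (exfalso; revert hp; norm_num; done)
        | (exfalso; omega)
        | decide
  obtain ⟨h1, h2, h3, h4⟩ := balancedTable_spec e he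
  obtain ⟨A, hA, hS, hcard⟩ := exists_isSType_one_of_list h1 h2 h3
  exact ⟨A, hA, hS, (Nat.mul_le_mul hcard hcard).trans_lt h4⟩

theorem two_mul_add_two_le_two_pow {h : ℕ} (hh : 3 ≤ h) : 2 * h + 2 ≤ 2 ^ h := by
  induction h, hh using Nat.le_induction with
  | base => norm_num
  | succ h hh ih =>
    rw [pow_succ]
    omega

/-- With `q = ⌊L / 2k⌋` one has `2^(2kq) ≤ 2^L ≤ p`, so `2L + 1 < 2^q` is enough. As `L < 2k(q+1)`,
this reduces to `4k(q+1) ≤ 2^q`; half of the exponent `q` pays for `4k ≤ k³`, the other half for `q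
+ 1`. -/
theorem log_sq_pow_lt {k : ℕ} (hk : 2 ≤ k) (hp : k ^ (40 * k) < p) :
    ((2 * Nat.log 2 p + 1) * (2 * Nat.log 2 p + 1)) ^ k < p := by
  set L := Nat.log 2 p with hL
  set q := L / (2 * k) with hq
  have hLq : L < 2 * k * (q + 1) := Nat.lt_mul_div_succ L (by omega)
  have hkq : k ^ 20 < 2 ^ (q + 1) := by
    rw [← Nat.pow_lt_pow_iff_left (n := 2 * k) (by omega), ← pow_mul, ← pow_mul]
    calc k ^ (20 * (2 * k)) = k ^ (40 * k) := by ring_nf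
      _ < p := hp
      _ < 2 ^ (L + 1) := Nat.lt_pow_succ_log_self (by norm_num) p
      _ ≤ 2 ^ ((q + 1) * (2 * k)) := Nat.pow_le_pow_right (by norm_num) (by linarith)
  have hq20 : 20 < q + 1 := by
    rw [← Nat.pow_lt_pow_iff_right (a := 2) (by norm_num)]
    exact (Nat.pow_le_pow_left hk 20).trans_lt hkq
  -- Since `q ≥ 20` gives `q + 1 ≤ 6⌊q/2⌋`, failure would give `2^(q+1) ≤ k^18`, against `k^20 <
  -- 2^(q+1)`.
  have hk3 : k ^ 3 < 2 ^ (q / 2) := by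
    by_contra! h
    have h1 : 2 ^ (q + 1) ≤ k ^ 18 := calc
      2 ^ (q + 1) ≤ 2 ^ (q / 2 * 6) := Nat.pow_le_pow_right (by norm_num) (by omega)
      _ = (2 ^ (q / 2)) ^ 6 := pow_mul _ _ _
      _ ≤ (k ^ 3) ^ 6 := Nat.pow_le_pow_left h 6
      _ = k ^ 18 := by rw [← pow_mul]
    exact absurd (h1.trans (Nat.pow_le_pow_right (by omega) (by norm_num))) (not_le.mpr hkq)
  have hmain : 4 * k * (q + 1) ≤ 2 ^ q := calc
    4 * k * (q + 1) ≤ 2 ^ (q / 2) * 2 ^ (q / 2) := by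
      refine Nat.mul_le_mul (le_trans ?_ hk3.le) ?_
      · nlinarith [Nat.mul_le_mul hk hk]
      · have := two_mul_add_two_le_two_pow (h := q / 2) (by omega)
        omega
    _ = 2 ^ (q / 2 + q / 2) := (pow_add _ _ _).symm
    _ ≤ 2 ^ q := Nat.pow_le_pow_right (by norm_num) (by omega)
  have hlt : 2 * L + 1 < 2 ^ q := lt_of_lt_of_le (by linarith) hmain
  calc ((2 * L + 1) * (2 * L + 1)) ^ k = (2 * L + 1) ^ (2 * k) := by rw [← sq, ← pow_mul]
    _ < (2 ^ q) ^ (2 * k) := Nat.pow_lt_pow_left hlt (by omega)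
    _ = 2 ^ (q * (2 * k)) := (pow_mul _ _ _).symm
    _ ≤ 2 ^ L := Nat.pow_le_pow_right (by norm_num) (Nat.div_mul_le_self _ _)
    _ ≤ p := Nat.pow_log_le_self 2 (by omega)

end BalancedSets

end AJT

/-! ### Assembly of the three statements -/

theorem AJT.exists_avoiding_one (p n : ℕ) (hp : p.Prime) (h61 : 61 < p) (h79 : p ≠ 79)
    (M : Matrix (Fin n) (Fin n) (ZMod p)) (hM : M.det ≠ 0) (c d : Fin n → ZMod p) :
    ∃ x : Fin n → ZMod p, (∀ i, x i ≠ c i) ∧ (∀ i, M.mulVec x i ≠ d i) := by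
  have : Fact p.Prime := ⟨hp⟩
  obtain ⟨A, hA, hS, hcard⟩ := AJT.exists_isSType_one_card_sq_lt hp h61 h79
  have h := AJT.prod_mul_prod_ne_zero (r := 1) hA (hS.isNType_one hA) hA hS (by omega)
    (by simpa using hcard) M hM
  obtain ⟨x, hx, hMx⟩ := AJT.exists_avoiding_of_prod_ne_zero M h (fun i _ => c i) (fun i _ => d i)
  exact ⟨x, fun i => hx i 0, fun i => hMx i 0⟩

theorem theorem1 :
    -- (i)
    (∀ p k n : ℕ, p.Prime → 1 ≤ k → k < p → AJT.N k p * AJT.S k p < p - 1 →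
      ∀ M : Matrix (Fin n) (Fin n) (ZMod p), M.det ≠ 0 →
        (∏ i : Fin n, (1 - AJT.g (Pi.single i 1 : Fin n → ZMod p)) ^ k) *
          (∏ i : Fin n, (1 - AJT.g (M.row i)) ^ k) ≠ (0 : AJT.GroupRing p n)) ∧
    -- (ii)
    (∀ p n : ℕ, p.Prime → 61 < p → p ≠ 79 →
      ∀ M : Matrix (Fin n) (Fin n) (ZMod p), M.det ≠ 0 →
        ∀ c d : Fin n → ZMod p,
          ∃ x : Fin n → ZMod p, (∀ i, x i ≠ c i) ∧ (∀ i, M.mulVec x i ≠ d i)) ∧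
    -- (ii), in particular
    (∀ p n : ℕ, p.Prime → 61 < p → p ≠ 79 →
      ∀ M : Matrix (Fin n) (Fin n) (ZMod p), M.det ≠ 0 →
        ∃ x : Fin n → ZMod p, (∀ i, x i ≠ 0) ∧ (∀ i, M.mulVec x i ≠ 0)) ∧
    -- (iii)
    (∃ K : ℕ, ∀ k : ℕ, 2 ≤ k → ∀ p : ℕ, p.Prime → k ^ (K * k) < p →
      ∀ n : ℕ, ∀ M : Matrix (Fin n) (Fin n) (ZMod p), M.det ≠ 0 →
        ∀ c d : Fin n → Fin k → ZMod p,
          (∀ i, Function.Injective (c i)) → (∀ i, Function.Injective (d i)) →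
            ∃ x : Fin n → ZMod p,
              (∀ i l, x i ≠ c i l) ∧ (∀ i l, M.mulVec x i ≠ d i l)) := by
  refine ⟨?_, ?_, ?_, ?_⟩
  · intro p k n hp hk hkp hNS M hM
    have : Fact p.Prime := ⟨hp⟩
    obtain ⟨A, hA, hAN, hAcard⟩ := Nat.sInf_mem (s := {m : ℕ | ∃ A : Finset (ZMod p),
      A.Nonempty ∧ AJT.IsNType k A ∧ A.card = m})
      ⟨_, Finset.univ, Finset.univ_nonempty, AJT.isNType_univ k, rfl⟩
    obtain ⟨B, hB, hBS, hBcard⟩ := Nat.sInf_mem (s := {m : ℕ | ∃ A : Finset (ZMod p),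
      A.Nonempty ∧ AJT.IsSType k A ∧ A.card = m})
      ⟨_, Finset.univ, Finset.univ_nonempty, (AJT.isNType_univ k).1, rfl⟩
    have hcard : (A.card * B.card) ^ 1 < p := by
      rw [pow_one, hAcard, hBcard]
      exact hNS.trans_le (Nat.sub_le _ _)
    simpa using AJT.prod_mul_prod_ne_zero hA hAN hB hBS (by simpa using hkp) hcard M hM
  · exact AJT.exists_avoiding_one
  · intro p n hp h61 h79 M hM
    exact AJT.exists_avoiding_one p n hp h61 h79 M hM 0 0
  · refine ⟨40, fun k hk p hp hkp n M hM c d _ _ => ?_⟩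
    have : Fact p.Prime := ⟨hp⟩
    have hk_lt : k < p := (Nat.le_self_pow (by omega) k).trans_lt hkp
    obtain ⟨A, hA, hS, hcard⟩ := AJT.exists_isSType_one_card_le_log hp (by omega)
    -- Type `S_1` with `k` repetitions replaces type `S_k`: the exponent is `1 * k`, and the sets
    -- remain logarithmic in size.
    have h := AJT.prod_mul_prod_ne_zero (r := k) hA (hS.isNType_one hA) hA hS (by simpa using hk_lt)
      ((Nat.pow_le_pow_left (Nat.mul_le_mul hcard hcard) k).trans_lt (AJT.log_sq_pow_lt hk hkp)) M hM
    rw [one_mul] at h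
    exact AJT.exists_avoiding_of_prod_ne_zero M h c d
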